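/- **Setting.** Let $\mathcal G=(\mathcal V,\mathcal E)$ be a finite directed acyclic graph (parallel links allowed), $\mathcal S$ a finite set of sources, and $a,b:\mathcal S\to\mathcal P(\mathcal V)$ maps with $a(s)\cap b(s)=\emptyset$ for all $s$: source $s$ is available at the nodes of $a(s)$ and demanded at the nodes of $b(s)$. Source $s$ emits symbols $Y_s^1,Y_s^2,\dots$ in a finite alphabet $\mathcal Y_s$; the vectors $(Y_s^n)_{s\in\mathcal S}$, $n=1,2,\dots$, are independent and identically distributed, with an arbitrary joint law across $s$. Write $Y_s=Y_s^1$ and $Y_s^{(N)}=(Y_s^1,\dots,Y_s^N)$. For a link $e$ from $u$ to $v$ and a link $f$ from $u'$ to $v'$, write $f\to e$ if $v'=u$, $f\to w$ if $v'=w$, and $s\to e$ if $u\in a(s)$. Entropies $H$ and logarithms are to base 2. A network code of block length $N$ consists of finite message alphabets $\mathcal U_e^{(N)}$ for $e\in\mathcal E$; for each link $e$ an encoding function which maps $\big((Y_s^{(N)})_{s\to e},(U_f^{(N)})_{f\to e}\big)$ to the message $U_e^{(N)}\in\mathcal U_e^{(N)}$; and for each $s\in\mathcal S$ and $u\in b(s)$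 a decoding function which maps $\big((Y_{s'}^{(N)})_{u\in a(s')},(U_f^{(N)})_{f\to u}\big)$ to an estimate of $Y_s^{(N)}$ in $\mathcal Y_s^N$. A link capacity tuple $\mathbf C=(C_e)_{e\in\mathcal E}\in\mathbb R^{\mathcal E}$ is achievable if there is a sequence of network codes, one for each $N$, such that $\limsup_{N\to\infty}\frac1N\log|\mathcal U_e^{(N)}|\le C_e$ for every $e\in\mathcal E$ and such that, for every $s\in\mathcal S$ and $u\in b(s)$, the probability that the estimate of $Y_s^{(N)}$ formed at $u$ differs from $Y_s^{(N)}$ tends to $0$ as $N\to\infty$. Let $\mathcal R_{\mathrm{cs}}$ be the set of all achievable tuples. Let $\mathcal Z=\mathcal S\sqcup\mathcal E$. A function $h:\mathcal P(\mathcal Z)\to\mathbb R$ is a polymatroid if $h(\emptyset)=0$, $h(\alpha)\ge h(\beta)\ge0$ for $\beta\subseteq\alpha$, and $h(\alpha)+h(\beta)\ge h(\alpha\cap\beta)+h(\alpha\cup\beta)$ for all $\alpha,\beta$. It is entropic if there are jointly distributed random variables $(X_i)_{i\in\mathcal Z}$ with finite alphabets such that $h(\alpha)=H(X_i,\,i\in\alpha)$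 for all $\alpha\subseteq\mathcal Z$. Let $\Gamma$ be the set of all polymatroids, let $\Gamma^*$ be the set of all entropic functions, and let $\overline{\Gamma^*}$ (the almost entropic functions) be the closure of $\Gamma^*$ in the Euclidean space $\mathbb R^{\mathcal P(\mathcal Z)}$. Write $h(\alpha\mid\beta)=h(\alpha\cup\beta)-h(\beta)$. For a set $\Delta$ of functions $\mathcal P(\mathcal Z)\to\mathbb R$, let $\mathcal R_{\mathrm{cs}}(\Delta)$ be the set of all $\mathbf C\in\mathbb R^{\mathcal E}$ for which there is $h\in\Delta$ such that $$h(\alpha)-H(Y_s,\,s\in\alpha)=0,$$ $$h\big(e\mid\{f\in\mathcal S\cup\mathcal E:f\to e\}\big)=0,$$ $$h\big(s\mid\{s'\in\mathcal S:u\in a(s')\}\cup\{f\in\mathcal E:f\to u\}\big)=0,$$ $$h(e)\le C_e$$ for all $\alpha\subseteq\mathcal S$, $s\in\mathcal S$, $u\in b(s)$ and $e\in\mathcal E$. **Theorem (Outer bound).** For every such network with correlated sources, $$\mathcal R_{\mathrm{cs}}\subseteq\mathcal R_{\mathrm{cs}}(\overline{\Gamma^*})\subseteq\mathcal R_{\mathrm{cs}}(\Gamma).$$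 -/

import Mathlib

open MeasureTheory ProbabilityTheory Filter Topology

namespace NetCod

noncomputable section

/-! ### Shannon entropy, polymatroids and entropic functions -/

/-- The Shannon entropy, in bits, of a random variable `X` with values in a finite alphabet. -/
def entropy {Ω A : Type*} [MeasurableSpace Ω] [Finite A] (μ : Measure Ω) (X : Ω → A) : ℝ :=
  (∑ᶠ x : A, Real.negMulLog (μ.real (X ⁻¹' {x}))) / Real.log 2

/-- The joint entropy of the subfamily `(X i, i ∈ α)` of a family of random variables. -/
def jointEntropy {Ω ι : Type*} {A : ι → Type*} [MeasurableSpace Ω] [Finite ι] [∀ i, Finite (A i)]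
    (μ : Measure Ω) (X : ∀ i, Ω → A i) (α : Set ι) : ℝ :=
  entropy μ (fun ω => fun i : α => X i ω)

/-- A real-valued set function on the subsets of `Z` is a polymatroid if it vanishes at `∅`, is
monotone and nonnegative, and is submodular. -/
structure IsPolymatroid {Z : Type*} (h : Set Z → ℝ) : Prop where
  empty : h ∅ = 0
  mono : ∀ α β : Set Z, β ⊆ α → h β ≤ h α
  nonneg : ∀ α : Set Z, 0 ≤ h α
  submod : ∀ α β : Set Z, h (α ∩ β) + h (α ∪ β) ≤ h α + h β

/-- `Γ`: the set of all polymatroids over the ground set `Z`. -/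
def polymatroids (Z : Type*) : Set (Set Z → ℝ) := {h | IsPolymatroid h}

/-- `Γ*`: the set of all entropic functions over the finite ground set `Z`, that is, of all
functions `α ↦ H(X i, i ∈ α)` for jointly distributed random variables `(X i, i ∈ Z)` with finite
alphabets. -/
def entropicFunctions (Z : Type*) [Finite Z] : Set (Set Z → ℝ) :=
  {h | ∃ (Ω : Type) (_ : MeasurableSpace Ω) (μ : Measure Ω) (_ : IsProbabilityMeasure μ)
      (k : Z → ℕ) (X : ∀ i, Ω → Fin (k i)), (∀ i, Measurable (X i)) ∧
      ∀ α : Set Z, h α = jointEntropy μ X α}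

/-- The set of all almost entropic functions: the closure of `Γ*` in the finite-dimensional
Euclidean space of all real-valued functions on the subsets of `Z`. -/
def almostEntropicFunctions (Z : Type*) [Finite Z] : Set (Set Z → ℝ) :=
  closure (entropicFunctions Z)

/-- `h(α | β) = h(α ∪ β) - h(β)`. -/
def condValue {Z : Type*} (h : Set Z → ℝ) (α β : Set Z) : ℝ := h (α ∪ β) - h β

/-! ### Networks -/

/-- A directed acyclic network with nodes `V`, links `E` and sources `S`. The link `e` goes from
`tail e` to `head e`. The source `s` is available at the nodes in `a s` and demanded at the nodes
in `b s`. -/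
structure Network (V E S : Type*) where
  tail : E → V
  head : E → V
  /-- There is no directed cycle. -/
  acyclic : ∀ v : V, ¬ Relation.TransGen (fun u w => ∃ e, tail e = u ∧ head e = w) v v
  a : S → Set V
  b : S → Set V
  disjoint : ∀ s, Disjoint (a s) (b s)

namespace Network

variable {V E S : Type*} (G : Network V E S)

/-- The links entering the node `u`. -/
def inLinks (u : V) : Set E := {f | G.head f = u}

/-- The sources available at the node `u`. -/
def sourcesAt (u : V) : Set S := {s | u ∈ G.a s}

/-- Everything that is available at the node `u`, as a set of source and link variables: the
sources `s` with `u ∈ a s` and the links `f` that enter `u`. -/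
def available (u : V) : Set (S ⊕ E) := Sum.inl '' G.sourcesAt u ∪ Sum.inr '' G.inLinks u

/-- In a finite acyclic network the relation `f → e` between links is well founded. -/
theorem wellFounded_link [Finite E] : WellFounded (fun f e : E => f ∈ G.inLinks (G.tail e)) := by
  have key : ∀ f e : E, Relation.TransGen (fun f e : E => f ∈ G.inLinks (G.tail e)) f e →
      Relation.TransGen (fun u w => ∃ e, G.tail e = u ∧ G.head e = w) (G.tail f) (G.tail e) :=
    fun f e h => h.lift G.tail (fun f e hfe => ⟨f, rfl, hfe⟩)
  have hirr : Std.Irrefl (Relation.TransGen (fun f e : E => f ∈ G.inLinks (G.tail e))) :=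
    ⟨fun e he => G.acyclic _ (key e e he)⟩
  have hwf := Finite.wellFounded_of_trans_of_irrefl
    (Relation.TransGen (fun f e : E => f ∈ G.inLinks (G.tail e)))
  have hsub : Subrelation (fun f e : E => f ∈ G.inLinks (G.tail e))
      (Relation.TransGen (fun f e : E => f ∈ G.inLinks (G.tail e))) :=
    fun {f e} h => Relation.TransGen.single (r := fun f e : E => f ∈ G.inLinks (G.tail e)) h
  exact hsub.wf hwf

end Network

/-- A network code over blocks of `N` source symbols: finite message alphabets `U e`, a local
encoding function for each link, and a decoding function for each source and each node that
demands it. -/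
structure NetworkCode {V E S : Type*} (G : Network V E S) (𝒴 : S → Type*) (N : ℕ) where
  U : E → Type
  finite_U : ∀ e, Finite (U e)
  enc : ∀ e : E, (∀ s : G.sourcesAt (G.tail e), Fin N → 𝒴 s) →
    (∀ f : G.inLinks (G.tail e), U f) → U e
  dec : ∀ (s : S) (u : V), u ∈ G.b s → (∀ s' : G.sourcesAt u, Fin N → 𝒴 s') →
    (∀ f : G.inLinks u, U f) → (Fin N → 𝒴 s)

namespace NetworkCode

variable {V E S : Type*} {G : Network V E S} {𝒴 : S → Type*} {N : ℕ} [Finite E]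

/-- The messages sent on the links when the source blocks are `y`, computed along the acyclic
network by the local encoding functions. -/
def message (φ : NetworkCode G 𝒴 N) (y : ∀ s, Fin N → 𝒴 s) : ∀ e, φ.U e :=
  G.wellFounded_link.fix fun e ih => φ.enc e (fun s => y s) (fun f => ih f f.2)

theorem message_eq (φ : NetworkCode G 𝒴 N) (y : ∀ s, Fin N → 𝒴 s) (e : E) :
    φ.message y e = φ.enc e (fun s => y s) (fun f => φ.message y f) :=
  WellFounded.fix_eq _ _ _

/-- The reconstruction of the block of source `s` at the node `u ∈ b s` when the source blocks
are `y`. -/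
def decoded (φ : NetworkCode G 𝒴 N) (y : ∀ s, Fin N → 𝒴 s) (s : S) (u : V) (hu : u ∈ G.b s) :
    Fin N → 𝒴 s :=
  φ.dec s u hu (fun s' => y s') (fun f => φ.message y f)

end NetworkCode

section Regions

variable {V E S Ω : Type*} {𝒴 : S → Type*} [MeasurableSpace Ω] [Finite E]

/-- The first `N` symbols of all the sources. -/
def block (Y : ℕ → ∀ s, Ω → 𝒴 s) (N : ℕ) (ω : Ω) : ∀ s, Fin N → 𝒴 s := fun s n => Y n s ω

/-- A link capacity tuple `C` is achievable if there is a sequence of network codes, one for each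
block length `N`, such that `limsup (log |U e|) / N ≤ C e` for every link `e`, and such that the
probability of a decoding error tends to `0` for every source `s` at every node `u ∈ b s`. -/
def IsAchievable (G : Network V E S) (μ : Measure Ω) (Y : ℕ → ∀ s, Ω → 𝒴 s) (C : E → ℝ) : Prop :=
  ∃ φ : ∀ N : ℕ, NetworkCode G 𝒴 N,
    (∀ e, ∀ ε > 0, ∀ᶠ N : ℕ in atTop, Real.logb 2 (Nat.card ((φ N).U e)) / N ≤ C e + ε) ∧
    ∀ (s : S) (u : V) (hu : u ∈ G.b s),
      Tendsto (fun N => μ.real {ω | (φ N).decoded (block Y N ω) s u hu ≠ block Y N ω s})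
        atTop (𝓝 0)

/-- The achievable region: the set of all achievable link capacity tuples. -/
def achievableRegion (G : Network V E S) (μ : Measure Ω) (Y : ℕ → ∀ s, Ω → 𝒴 s) : Set (E → ℝ) :=
  {C | IsAchievable G μ Y C}

/-- The region cut out by a set `Δ` of functions on the subsets of `S ⊕ E`: all link capacity
tuples for which some `h ∈ Δ` agrees with the joint entropies of the source symbols, satisfies the
encoding and decoding constraints, and has `h(e) ≤ C e` for every link `e`. -/
def outerRegion [Finite S] [∀ s, Finite (𝒴 s)] (G : Network V E S) (μ : Measure Ω)
    (Y : ℕ → ∀ s, Ω → 𝒴 s) (Δ : Set (Set (S ⊕ E) → ℝ)) : Set (E → ℝ) :=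
  {C | ∃ h ∈ Δ,
    (∀ α : Set S, h (Sum.inl '' α) - jointEntropy μ (Y 0) α = 0) ∧
    (∀ e : E, condValue h {Sum.inr e} (G.available (G.tail e)) = 0) ∧
    (∀ s : S, ∀ u ∈ G.b s, condValue h {Sum.inl s} (G.available u) = 0) ∧
    ∀ e : E, h {Sum.inr e} ≤ C e}

end Regions

end

end NetCod

/-! For a code of block length `N`, let `g N` be the joint entropies of the source blocks and
messages, divided by `N`. As the sources are i.i.d., `g N` agrees with the single-letter entropies
on sets of sources. Messages are functions of what enters their encoders, so the encoding
constraints hold exactly. Fano's inequality bounds the decoding defect by `1 / N` plus a multiple of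
the error probability, and the entropy of a message is at most the logarithm of its alphabet size.
All values lie in `[0, H(Y_S)]`, so a limit `h` exists by compactness, and it satisfies every
constraint.

That `h` is almost entropic needs the factor `1 / N`:
`IsProbWeight.smul_mem_almostEntropicFunctions` approximates `c * H` by taking `k` independent
copies and keeping them only with probability `c / k`, at the cost of a binary entropy tending to
`0`. The second inclusion holds because polymatroids form a closed set containing the entropic
functions, by strong subadditivity.

Random variables are replaced by partitions of a finite weighted space. The entropy inequalities
follow from a Gibbs inequality whose comparison function `q` lives on points: its averages over the
classes must sum to at most one. -/

namespace NetCod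

/-! ### Entropy of partitions of a finite weighted space -/

section FiniteEntropy

variable {W : Type*} [Fintype W]

open scoped Classical in
/-- The total weight of the class of `w`. -/
noncomputable def classMass (p : W → ℝ) (r : Setoid W) (w : W) : ℝ :=
  ∑ w', if r w w' then p w' else 0

/-- The entropy, in nats, of the partition of a finite weighted space into the classes of `r`. -/
noncomputable def partEntropy (p : W → ℝ) (r : Setoid W) : ℝ :=
  ∑ w, p w * -Real.log (classMass p r w)

/-- Nonnegative weights of total mass one. -/
structure IsProbWeight (p : W → ℝ) : Prop where
  nonneg : ∀ w, 0 ≤ p w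
  sum_eq_one : ∑ w, p w = 1

variable {p : W → ℝ}

theorem classMass_congr {r : Setoid W} {u v : W} (h : r u v) :
    classMass p r u = classMass p r v := by
  classical
  unfold classMass
  refine Finset.sum_congr rfl fun w _ => ?_
  have : r u w ↔ r v w := ⟨fun h' => r.trans (r.symm h) h', fun h' => r.trans h h'⟩
  simp only [this]

namespace IsProbWeight

theorem classMass_nonneg (hp : IsProbWeight p) (r : Setoid W) (w : W) : 0 ≤ classMass p r w := by
  classical
  exact Finset.sum_nonneg fun w' _ => by split_ifs <;> simp [hp.nonneg]

theorem classMass_mono (hp : IsProbWeight p) {r r' : Setoid W} (h : r ≤ r') (w : W) :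
    classMass p r w ≤ classMass p r' w := by
  classical
  refine Finset.sum_le_sum fun w' _ => ?_
  by_cases hr : r w w'
  · rw [if_pos hr, if_pos (h hr)]
  · rw [if_neg hr]
    split_ifs <;> simp [hp.nonneg]

theorem le_classMass (hp : IsProbWeight p) (r : Setoid W) (w : W) : p w ≤ classMass p r w := by
  classical
  have := Finset.single_le_sum (f := fun w' => if r w w' then p w' else 0)
    (fun w' _ => by split_ifs <;> simp [hp.nonneg]) (Finset.mem_univ w)
  simpa [classMass, r.refl w] using this

theorem classMass_top (hp : IsProbWeight p) (w : W) : classMass p ⊤ w = 1 := by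
  simpa [classMass] using hp.sum_eq_one

theorem classMass_le_one (hp : IsProbWeight p) (r : Setoid W) (w : W) : classMass p r w ≤ 1 :=
  (hp.classMass_mono le_top w).trans_eq (hp.classMass_top w)

theorem partEntropy_top (hp : IsProbWeight p) : partEntropy p ⊤ = 0 := by
  simp [partEntropy, hp.classMass_top]

theorem partEntropy_nonneg (hp : IsProbWeight p) (r : Setoid W) : 0 ≤ partEntropy p r :=
  Finset.sum_nonneg fun w _ => mul_nonneg (hp.nonneg w) (neg_nonneg.2
    (Real.log_nonpos (hp.classMass_nonneg r w) (hp.classMass_le_one r w)))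

theorem partEntropy_anti (hp : IsProbWeight p) {r r' : Setoid W} (h : r ≤ r') :
    partEntropy p r' ≤ partEntropy p r := by
  refine Finset.sum_le_sum fun w _ => ?_
  rcases (hp.nonneg w).eq_or_lt with h0 | h0
  · simp [← h0]
  · exact mul_le_mul_of_nonneg_left (neg_le_neg (Real.log_le_log
      (h0.trans_le (hp.le_classMass r w)) (hp.classMass_mono h w))) h0.le

/-- The set `P` lies inside one class, so the denominator is constant on it and bounds the total of
the numerators. An empty `P` or a class of mass zero gives `0`, hence only an inequality. Each
verification of the sum condition in Gibbs' inequality reduces to this. -/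
theorem sum_div_classMass_le_one (hp : IsProbWeight p) (r : Setoid W) (P : W → Prop)
    [DecidablePred P] (hP : ∀ u v, P u → P v → r u v) :
    ∑ w, (if P w then p w / classMass p r w else 0) ≤ 1 := by
  classical
  by_cases hne : ∃ u, P u
  · obtain ⟨u, hu⟩ := hne
    calc ∑ w, (if P w then p w / classMass p r w else 0)
        ≤ ∑ w, (if r u w then p w else 0) / classMass p r u := by
          refine Finset.sum_le_sum fun w _ => ?_
          by_cases hw : P w
          · rw [if_pos hw, if_pos (hP u w hu hw), classMass_congr (hP u w hu hw)]
          · rw [if_neg hw]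
            refine div_nonneg ?_ (hp.classMass_nonneg r u)
            split_ifs <;> simp [hp.nonneg]
      _ = classMass p r u / classMass p r u := by
          rw [← Finset.sum_div]
          simp only [classMass]
      _ ≤ 1 := div_self_le_one _
  · push Not at hne
    simp [hne]

/-- Gibbs' inequality. -/
theorem partEntropy_le_of_sum_le (hp : IsProbWeight p) (r : Setoid W) (q : W → ℝ)
    (hq : ∀ w, 0 < p w → 0 < q w) (hsum : ∑ w, p w * (q w / classMass p r w) ≤ 1) :
    partEntropy p r ≤ ∑ w, p w * -Real.log (q w) := by
  have key : ∀ w, p w * -Real.log (classMass p r w) - p w * -Real.log (q w) ≤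
      p w * (q w / classMass p r w) - p w := by
    intro w
    rcases (hp.nonneg w).eq_or_lt with h0 | h0
    · simp [← h0]
    · have hm := h0.trans_le (hp.le_classMass r w)
      have := Real.log_le_sub_one_of_pos (div_pos (hq w h0) hm)
      rw [Real.log_div (hq w h0).ne' hm.ne'] at this
      nlinarith
  have := Finset.sum_le_sum fun w (_ : w ∈ Finset.univ) => key w
  rw [Finset.sum_sub_distrib, Finset.sum_sub_distrib, hp.sum_eq_one] at this
  unfold partEntropy
  linarith

theorem sum_mul_neg_log_mul (hp : IsProbWeight p) {q₁ q₂ : W → ℝ} (h₁ : ∀ w, 0 < p w → 0 < q₁ w)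
    (h₂ : ∀ w, 0 < p w → 0 < q₂ w) :
    ∑ w, p w * -Real.log (q₁ w * q₂ w) =
      ∑ w, p w * -Real.log (q₁ w) + ∑ w, p w * -Real.log (q₂ w) := by
  rw [← Finset.sum_add_distrib]
  refine Finset.sum_congr rfl fun w _ => ?_
  rcases (hp.nonneg w).eq_or_lt with h0 | h0
  · simp [← h0]
  · rw [Real.log_mul (h₁ w h0).ne' (h₂ w h0).ne']
    ring

theorem classMass_pos (hp : IsProbWeight p) (r : Setoid W) (w : W) (h : 0 < p w) :
    0 < classMass p r w :=
  h.trans_le (hp.le_classMass r w)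

/-- Strong subadditivity of entropy. -/
theorem partEntropy_inf_add_le (hp : IsProbWeight p) {r r' z : Setoid W} (h : r ≤ z)
    (h' : r' ≤ z) :
    partEntropy p (r ⊓ r') + partEntropy p z ≤ partEntropy p r + partEntropy p r' := by
  classical
  have hz := hp.classMass_pos z
  have hr := hp.classMass_pos r
  have hr' := hp.classMass_pos r'
  -- The comparison function makes `r` and `r'` conditionally independent given `z`.
  have hq : ∀ w, 0 < p w → 0 < classMass p r w * classMass p r' w / classMass p z w :=
    fun w hw => div_pos (mul_pos (hr w hw) (hr' w hw)) (hz w hw)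
  have hsum : ∑ w, p w * (classMass p r w * classMass p r' w / classMass p z w /
      classMass p (r ⊓ r') w) ≤ 1 := by
    calc ∑ w, p w * (classMass p r w * classMass p r' w / classMass p z w /
          classMass p (r ⊓ r') w)
        = ∑ w, ∑ u, ∑ v, (if r w u then p u else 0) * (if r' w v then p v else 0) *
            (p w / classMass p (r ⊓ r') w) / classMass p z w := by
          refine Finset.sum_congr rfl fun w _ => ?_
          simp_rw [← Finset.sum_div, ← Finset.sum_mul, ← Finset.mul_sum, ← Finset.sum_mul]
          simp only [classMass]
          ring
      _ = ∑ u, ∑ v, ∑ w, (if r w u then p u else 0) * (if r' w v then p v else 0) *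
            (p w / classMass p (r ⊓ r') w) / classMass p z w := by
          rw [Finset.sum_comm]
          exact Finset.sum_congr rfl fun u _ => Finset.sum_comm
      -- For fixed `u` and `v`, the `w` with `r w u` and `r' w v` lie in a single class of `r ⊓ r'`;
      -- if there is any, then `u`, `v` and `w` share a class of `z`.
      _ ≤ ∑ u, ∑ v, p u * (if z u v then p v else 0) / classMass p z u := by
          refine Finset.sum_le_sum fun u _ => Finset.sum_le_sum fun v _ => ?_
          calc ∑ w, (if r w u then p u else 0) * (if r' w v then p v else 0) *
                (p w / classMass p (r ⊓ r') w) / classMass p z w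
              = ∑ w, (p u * (if z u v then p v else 0) / classMass p z u) *
                  (if r w u ∧ r' w v then p w / classMass p (r ⊓ r') w else 0) := by
                refine Finset.sum_congr rfl fun w _ => ?_
                by_cases h1 : r w u
                · by_cases h2 : r' w v
                  · have hzu : z w u := h h1
                    have hzv : z u v := z.trans (z.symm hzu) (h' h2)
                    rw [if_pos h1, if_pos h2, if_pos hzv, if_pos ⟨h1, h2⟩, classMass_congr hzu]
                    ring
                  · simp [h2]
                · simp [h1]
            _ ≤ p u * (if z u v then p v else 0) / classMass p z u := by
                rw [← Finset.mul_sum]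
                refine mul_le_of_le_one_right ?_ ?_
                · refine div_nonneg (mul_nonneg (hp.nonneg u) ?_) (hp.classMass_nonneg z u)
                  split_ifs <;> simp [hp.nonneg]
                · refine hp.sum_div_classMass_le_one (r ⊓ r') _ fun w₁ w₂ h1 h2 => ?_
                  exact ⟨r.trans h1.1 (r.symm h2.1), r'.trans h1.2 (r'.symm h2.2)⟩
      _ = ∑ u, p u * (classMass p z u / classMass p z u) := by
          refine Finset.sum_congr rfl fun u _ => ?_
          rw [← Finset.sum_div, ← Finset.mul_sum, mul_div_assoc, classMass]
      _ ≤ ∑ u, p u := Finset.sum_le_sum fun u _ =>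
          mul_le_of_le_one_right (hp.nonneg u) (div_self_le_one _)
      _ = 1 := hp.sum_eq_one
  have hg := hp.partEntropy_le_of_sum_le (r ⊓ r') _ hq hsum
  have e1 := hp.sum_mul_neg_log_mul hq hz
  have e2 := hp.sum_mul_neg_log_mul hr hr'
  have e3 : ∑ w, p w * -Real.log (classMass p r w * classMass p r' w / classMass p z w *
      classMass p z w) = ∑ w, p w * -Real.log (classMass p r w * classMass p r' w) := by
    refine Finset.sum_congr rfl fun w _ => ?_
    rcases (hp.nonneg w).eq_or_lt with h0 | h0
    · simp [← h0]
    · rw [div_mul_cancel₀ _ (hz w h0).ne']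
  simp only [partEntropy] at *
  linarith

/-- Gibbs' inequality against the constant `1 / |A|`: each fibre of `f` contributes at most `1 /
|A|` to the sum. -/
theorem partEntropy_ker_le_log_card (hp : IsProbWeight p) {A : Type*} [Finite A] (f : W → A) :
    partEntropy p (Setoid.ker f) ≤ Real.log (Nat.card A) := by
  classical
  have := Fintype.ofFinite A
  have hW : Nonempty W := by
    by_contra hW
    rw [not_nonempty_iff] at hW
    simpa using hp.sum_eq_one
  have hA : 0 < (Nat.card A : ℝ) := by
    have : Nonempty A := hW.map f
    exact_mod_cast Nat.card_pos
  refine (hp.partEntropy_le_of_sum_le _ (fun _ => (Nat.card A : ℝ)⁻¹)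
    (fun _ _ => inv_pos.2 hA) ?_).trans_eq ?_
  · calc ∑ w, p w * ((Nat.card A : ℝ)⁻¹ / classMass p (Setoid.ker f) w)
        = (Nat.card A : ℝ)⁻¹ * ∑ a : A, ∑ w,
            (if f w = a then p w / classMass p (Setoid.ker f) w else 0) := by
          rw [Finset.sum_comm, Finset.mul_sum]
          refine Finset.sum_congr rfl fun w _ => ?_
          simp
          ring
      _ ≤ (Nat.card A : ℝ)⁻¹ * ∑ a : A, 1 := by
          refine mul_le_mul_of_nonneg_left (Finset.sum_le_sum fun a _ => ?_) (inv_pos.2 hA).le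
          exact hp.sum_div_classMass_le_one _ (fun w => f w = a) fun u v hu hv =>
            Setoid.ker_def.2 (hu.trans hv.symm)
      _ = 1 := by
          simp only [Finset.sum_const, Finset.card_univ, nsmul_eq_mul, mul_one,
            ← Nat.card_eq_fintype_card]
          exact inv_mul_cancel₀ hA.ne'
  · rw [← Finset.sum_mul, hp.sum_eq_one]
    simp

/-- Fano's inequality. -/
theorem partEntropy_ker_inf_le (hp : IsProbWeight p) {A : Type*} [Finite A] [DecidableEq A] (f g : W → A)
    (z : Setoid W) (hg : z ≤ Setoid.ker g) :
    partEntropy p (Setoid.ker f ⊓ z) ≤ partEntropy p z +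
      (Real.log 2 + (∑ w, if f w ≠ g w then p w else 0) * Real.log (Nat.card A)) := by
  classical
  have := Fintype.ofFinite A
  have hW : Nonempty W := by
    by_contra hW
    rw [not_nonempty_iff] at hW
    simpa using hp.sum_eq_one
  have hA : 0 < (Nat.card A : ℝ) := by
    have : Nonempty A := hW.map f
    exact_mod_cast Nat.card_pos
  set κ : ℝ := (Nat.card A : ℝ) with hκ
  -- A guess at `f` given `g`: half the mass sits on the value of `g`, half is spread evenly over
  -- `A`. The fixed weight `1 / 2` yields `log 2` instead of the binary entropy of the error, which
  -- is harmless after division by the block length.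
  set Q : A → A → ℝ := fun a b => if a = b then 1 / 2 else 1 / 2 * κ⁻¹ with hQ
  have hQpos : ∀ a b, 0 < Q a b := by
    intro a b
    simp only [hQ]
    split_ifs <;> positivity
  have hQsum : ∀ b, ∑ a, Q a b ≤ 1 := by
    intro b
    calc ∑ a, Q a b ≤ ∑ a, ((if a = b then 1 / 2 else 0) + 1 / 2 * κ⁻¹) := by
          refine Finset.sum_le_sum fun a _ => ?_
          simp only [hQ]
          split_ifs
          · have : 0 < κ⁻¹ := inv_pos.2 hA
            linarith
          · simp
      _ = 1 := by
          rw [Finset.sum_add_distrib]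
          simp only [Finset.sum_ite_eq', Finset.mem_univ, if_true, Finset.sum_const,
            Finset.card_univ, nsmul_eq_mul, ← Nat.card_eq_fintype_card, ← hκ]
          field_simp
          norm_num
  have hz := hp.classMass_pos z
  have hsum : ∑ w, p w * (classMass p z w * Q (f w) (g w) / classMass p (Setoid.ker f ⊓ z) w)
      ≤ 1 := by
    calc ∑ w, p w * (classMass p z w * Q (f w) (g w) / classMass p (Setoid.ker f ⊓ z) w)
        = ∑ w, ∑ u, ∑ a, p u * (Q a (g u) * if z u w ∧ f w = a then
            p w / classMass p (Setoid.ker f ⊓ z) w else 0) := by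
          refine Finset.sum_congr rfl fun w _ => ?_
          have : ∀ u, ∑ a, p u * (Q a (g u) * if z u w ∧ f w = a then
              p w / classMass p (Setoid.ker f ⊓ z) w else 0) = (if z w u then p u else 0) *
                (Q (f w) (g w) * (p w / classMass p (Setoid.ker f ⊓ z) w)) := by
            intro u
            by_cases hu : z w u
            -- Here `z ≤ Setoid.ker g` enters: the guess is constant on classes of `z`, so it can be
            -- read off at `u`.
            · have hgu : g w = g u := hg hu
              simp [hu, z.symm hu, hgu]
            · have hu' : ¬ z u w := fun h => hu (z.symm h)
              simp [hu, hu']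
          simp_rw [this]
          rw [← Finset.sum_mul, classMass]
          ring
      _ = ∑ u, p u * ∑ a, Q a (g u) * ∑ w, if z u w ∧ f w = a then
            p w / classMass p (Setoid.ker f ⊓ z) w else 0 := by
          rw [Finset.sum_comm]
          refine Finset.sum_congr rfl fun u _ => ?_
          rw [Finset.sum_comm, Finset.mul_sum]
          refine Finset.sum_congr rfl fun a _ => ?_
          rw [Finset.mul_sum, Finset.mul_sum]
      _ ≤ ∑ u, p u * ∑ a, Q a (g u) := by
          refine Finset.sum_le_sum fun u _ => mul_le_mul_of_nonneg_left
            (Finset.sum_le_sum fun a _ => mul_le_of_le_one_right (hQpos _ _).le ?_) (hp.nonneg u)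
          refine hp.sum_div_classMass_le_one _ _ fun w₁ w₂ h1 h2 => ?_
          exact ⟨h1.2.trans h2.2.symm, z.trans (z.symm h1.1) h2.1⟩
      _ ≤ ∑ u, p u := Finset.sum_le_sum fun u _ =>
          mul_le_of_le_one_right (hp.nonneg u) (hQsum _)
      _ = 1 := hp.sum_eq_one
  have hq := hp.partEntropy_le_of_sum_le _ _ (fun w hw => mul_pos (hz w hw) (hQpos _ _)) hsum
  rw [hp.sum_mul_neg_log_mul hz (fun w _ => hQpos (f w) (g w))] at hq
  refine hq.trans_eq ?_
  congr 1
  have hlog : ∀ w, p w * -Real.log (Q (f w) (g w)) =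
      p w * Real.log 2 + (if f w ≠ g w then p w else 0) * Real.log κ := by
    intro w
    by_cases h : f w = g w
    · simp [hQ, h]
    · simp only [hQ, if_neg h, ne_eq, h, not_false_eq_true, if_true]
      rw [Real.log_mul (by norm_num) (inv_pos.2 hA).ne', Real.log_inv]
      simp
      ring
  simp_rw [hlog]
  rw [Finset.sum_add_distrib, ← Finset.sum_mul, ← Finset.sum_mul, hp.sum_eq_one, one_mul]

end IsProbWeight

/-! ### Powers -/

/-- The product weights on `k`-tuples. -/
def powWeight (p : W → ℝ) (k : ℕ) (w : Fin k → W) : ℝ := ∏ n, p (w n)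

/-- The coordinatewise equivalence on `k`-tuples. -/
def powSetoid (r : Setoid W) (k : ℕ) : Setoid (Fin k → W) where
  r w w' := ∀ n, r (w n) (w' n)
  iseqv := ⟨fun _ _ => r.refl _, fun h n => r.symm (h n), fun h h' n => r.trans (h n) (h' n)⟩

theorem powSetoid_apply {W : Type*} (r : Setoid W) (k : ℕ) (w w' : Fin k → W) :
    powSetoid r k w w' ↔ ∀ n, r (w n) (w' n) := Iff.rfl

theorem IsProbWeight.powWeight (hp : IsProbWeight p) (k : ℕ) : IsProbWeight (powWeight p k) where
  nonneg w := Finset.prod_nonneg fun _ _ => hp.nonneg _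
  sum_eq_one := by
    classical
    have := (Finset.prod_univ_sum (fun _ : Fin k => (Finset.univ : Finset W))
      (fun _ w => p w)).symm
    simpa [NetCod.powWeight, hp.sum_eq_one] using this

theorem classMass_powSetoid (p : W → ℝ) (r : Setoid W) (k : ℕ) (w : Fin k → W) :
    classMass (powWeight p k) (powSetoid r k) w = ∏ n, classMass p r (w n) := by
  classical
  unfold classMass
  rw [Finset.prod_univ_sum, Fintype.piFinset_univ]
  refine Finset.sum_congr rfl fun w' _ => ?_
  rw [Finset.prod_ite_zero]
  have : powSetoid r k w w' ↔ ∀ n ∈ Finset.univ, r (w n) (w' n) := by simp [powSetoid_apply]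
  by_cases h : ∀ n ∈ Finset.univ, r (w n) (w' n)
  · rw [if_pos h, if_pos (this.2 h), powWeight]
  · rw [if_neg h, if_neg (mt this.1 h)]

theorem IsProbWeight.sum_powWeight_mul (hp : IsProbWeight p) (k : ℕ) (n : Fin k) (g : W → ℝ) :
    ∑ w, NetCod.powWeight p k w * g (w n) = ∑ w, p w * g w := by
  classical
  have h : ∀ w : Fin k → W, NetCod.powWeight p k w * g (w n) =
      ∏ m, p (w m) * (if m = n then g (w m) else 1) := by
    intro w
    rw [Finset.prod_mul_distrib, Finset.prod_ite_eq']
    simp [NetCod.powWeight]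
  simp_rw [h]
  have := (Finset.prod_univ_sum (fun _ : Fin k => (Finset.univ : Finset W))
    (fun m w => p w * (if m = n then g w else 1)))
  rw [Fintype.piFinset_univ] at this
  rw [← this, Finset.prod_eq_single n]
  · simp
  · intro m _ hm
    simp [hm, hp.sum_eq_one]
  · simp

/-- Class masses multiply over coordinates, so their logarithms add, and each coordinate has
marginal `p`. -/
theorem IsProbWeight.partEntropy_pow (hp : IsProbWeight p) (r : Setoid W) (k : ℕ) :
    partEntropy (NetCod.powWeight p k) (powSetoid r k) = k * partEntropy p r := by
  calc partEntropy (NetCod.powWeight p k) (powSetoid r k)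
      = ∑ w, ∑ n, NetCod.powWeight p k w * -Real.log (classMass p r (w n)) := by
        refine Finset.sum_congr rfl fun w _ => ?_
        rw [← Finset.mul_sum, Finset.sum_neg_distrib]
        rcases ((hp.powWeight k).nonneg w).eq_or_lt with h0 | h0
        · simp [← h0]
        · rw [classMass_powSetoid, Real.log_prod]
          intro n _
          refine (hp.classMass_pos r _ ((hp.nonneg _).lt_of_ne' fun h => h0.ne' ?_)).ne'
          exact Finset.prod_eq_zero (Finset.mem_univ n) h
    _ = ∑ n : Fin k, partEntropy p r := by
        rw [Finset.sum_comm]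
        refine Finset.sum_congr rfl fun n _ => ?_
        exact hp.sum_powWeight_mul k n fun w => -Real.log (classMass p r w)
    _ = k * partEntropy p r := by simp

/-! ### Mixing with a constant -/

/-- The mixture, with probability `t`, of the weights `p` and, with probability `1 - t`, of the
point mass at an additional point. -/
def mixWeight (p : W → ℝ) (t : ℝ) : Option W → ℝ
  | none => 1 - t
  | some w => t * p w

/-- The extension of an equivalence by an additional singleton class. -/
def mixSetoid (r : Setoid W) : Setoid (Option W) where
  r := Option.Rel r
  iseqv := by
    refine ⟨fun x => ?_, fun {x y} h => ?_, fun {x y z} h h' => ?_⟩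
    · cases x
      · exact .none
      · exact .some (r.refl _)
    · cases h with
      | none => exact .none
      | some h => exact .some (r.symm h)
    · cases h with
      | none => exact h'
      | some h => cases h' with
        | some h' => exact .some (r.trans h h')

@[simp] theorem mixSetoid_some_some {W : Type*} (r : Setoid W) (u v : W) :
    mixSetoid r (some u) (some v) ↔ r u v :=
  ⟨fun h => by cases h; assumption, fun h => .some h⟩

@[simp] theorem mixSetoid_none_none {W : Type*} (r : Setoid W) : mixSetoid r none none :=
  Option.Rel.none

@[simp] theorem not_mixSetoid_some_none {W : Type*} (r : Setoid W) (u : W) : ¬ mixSetoid r (some u) none :=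
  fun h => by cases h

@[simp] theorem not_mixSetoid_none_some {W : Type*} (r : Setoid W) (u : W) : ¬ mixSetoid r none (some u) :=
  fun h => by cases h

theorem IsProbWeight.mixWeight (hp : IsProbWeight p) {t : ℝ} (h0 : 0 ≤ t) (h1 : t ≤ 1) :
    IsProbWeight (mixWeight p t) where
  nonneg w := by
    cases w
    · simpa [NetCod.mixWeight] using h1
    · exact mul_nonneg h0 (hp.nonneg _)
  sum_eq_one := by
    simp [NetCod.mixWeight, ← Finset.mul_sum, hp.sum_eq_one]

/-- Chain rule: every partition `mixSetoid r` reveals whether the extra point occurred, which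
accounts for the binary entropy. -/
theorem IsProbWeight.partEntropy_mix (hp : IsProbWeight p) (r : Setoid W) {t : ℝ} (h0 : 0 < t) :
    partEntropy (NetCod.mixWeight p t) (mixSetoid r) = t * partEntropy p r + Real.binEntropy t := by
  classical
  have hn : classMass (NetCod.mixWeight p t) (mixSetoid r) none = 1 - t := by
    simp [classMass, NetCod.mixWeight]
  have hs : ∀ w, classMass (NetCod.mixWeight p t) (mixSetoid r) (some w) = t * classMass p r w := by
    intro w
    simp [classMass, NetCod.mixWeight, Finset.mul_sum]
  unfold partEntropy
  rw [Fintype.sum_option, hn]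
  have : ∀ w, NetCod.mixWeight p t (some w) *
      -Real.log (classMass (NetCod.mixWeight p t) (mixSetoid r) (some w)) =
      t * (p w * -Real.log (classMass p r w)) + p w * (t * -Real.log t) := by
    intro w
    rw [hs]
    rcases (hp.nonneg w).eq_or_lt with hw | hw
    · simp [NetCod.mixWeight, ← hw]
    · rw [Real.log_mul h0.ne' (hp.classMass_pos r w hw).ne', NetCod.mixWeight]
      ring
  simp_rw [this]
  rw [Finset.sum_add_distrib, ← Finset.mul_sum, ← Finset.sum_mul, hp.sum_eq_one, NetCod.mixWeight,
    Real.binEntropy, Real.log_inv, Real.log_inv]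
  ring

/-! ### Families of partitions -/

/-- The common refinement of the partitions in the subfamily `α`. -/
def jointSetoid {W Z : Type*} (r : Z → Setoid W) (α : Set Z) : Setoid W where
  r w w' := ∀ i ∈ α, r i w w'
  iseqv := ⟨fun _ _ _ => (r _).refl _, fun h i hi => (r i).symm (h i hi),
    fun h h' i hi => (r i).trans (h i hi) (h' i hi)⟩

section Joint

variable {Z : Type*}

theorem jointSetoid_apply {W : Type*} (r : Z → Setoid W) (α : Set Z) (w w' : W) :
    jointSetoid r α w w' ↔ ∀ i ∈ α, r i w w' := Iff.rfl

theorem jointSetoid_anti {W : Type*} (r : Z → Setoid W) {α β : Set Z} (h : α ⊆ β) :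
    jointSetoid r β ≤ jointSetoid r α := fun _ _ hw i hi => hw i (h hi)

theorem jointSetoid_union {W : Type*} (r : Z → Setoid W) (α β : Set Z) :
    jointSetoid r (α ∪ β) = jointSetoid r α ⊓ jointSetoid r β := by
  ext w w'
  exact ⟨fun h => ⟨fun i hi => h i (.inl hi), fun i hi => h i (.inr hi)⟩,
    fun h i hi => hi.elim (h.1 i) (h.2 i)⟩

theorem jointSetoid_empty {W : Type*} (r : Z → Setoid W) : jointSetoid r ∅ = ⊤ := by
  ext w w'
  simp [jointSetoid_apply]

theorem jointSetoid_singleton {W : Type*} (r : Z → Setoid W) (i : Z) :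
    jointSetoid r {i} = r i := by
  ext w w'
  simp [jointSetoid_apply]

theorem jointSetoid_pow {W : Type*} (r : Z → Setoid W) (k : ℕ) (α : Set Z) :
    jointSetoid (fun i => powSetoid (r i) k) α = powSetoid (jointSetoid r α) k := by
  ext w w'
  exact ⟨fun h n i hi => h i hi n, fun h i hi n => h n i hi⟩

/-- Nonemptiness matters: the empty family separates nothing, whereas `mixSetoid ⊤` still splits off
the extra point. -/
theorem jointSetoid_mix {W : Type*} (r : Z → Setoid W) {α : Set Z} (hα : α.Nonempty) :
    jointSetoid (fun i => mixSetoid (r i)) α = mixSetoid (jointSetoid r α) := by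
  obtain ⟨j, hj⟩ := hα
  ext w w'
  rw [jointSetoid_apply]
  cases w <;> cases w'
  · simp
  · simpa using ⟨j, hj⟩
  · simpa using ⟨j, hj⟩
  · simp [jointSetoid_apply]

/-- Submodularity is strong subadditivity with the partition of `α ∩ β` as the common coarsening. -/
theorem IsProbWeight.isPolymatroid (hp : IsProbWeight p) (r : Z → Setoid W) {c : ℝ} (hc : 0 ≤ c) :
    IsPolymatroid fun α => c * partEntropy p (jointSetoid r α) where
  empty := by rw [jointSetoid_empty, hp.partEntropy_top, mul_zero]
  mono α β h := mul_le_mul_of_nonneg_left (hp.partEntropy_anti (jointSetoid_anti r h)) hc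
  nonneg α := mul_nonneg hc (hp.partEntropy_nonneg _)
  submod α β := by
    rw [jointSetoid_union, ← mul_add, ← mul_add, add_comm]
    exact mul_le_mul_of_nonneg_left (hp.partEntropy_inf_add_le
      (jointSetoid_anti r Set.inter_subset_left) (jointSetoid_anti r Set.inter_subset_right)) hc

end Joint

end FiniteEntropy

/-! ### From random variables to weighted partitions -/

section Law

variable {Ω W : Type*} [MeasurableSpace Ω] [Fintype W] {μ : Measure Ω}

/-- The point masses of the distribution of `T`. -/
noncomputable def law (μ : Measure Ω) (T : Ω → W) (w : W) : ℝ := μ.real (T ⁻¹' {w})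

theorem measureReal_setOf_eq_sum_law [IsFiniteMeasure μ] {T : Ω → W}
    (hT : ∀ w, MeasurableSet (T ⁻¹' {w})) (P : W → Prop) [DecidablePred P] :
    μ.real {ω | P (T ω)} = ∑ w, if P w then law μ T w else 0 := by
  rw [← Finset.sum_filter]
  unfold law
  rw [sum_measureReal_preimage_singleton _ fun w _ => hT w]
  simp [Set.preimage]

theorem isProbWeight_law [IsProbabilityMeasure μ] {T : Ω → W}
    (hT : ∀ w, MeasurableSet (T ⁻¹' {w})) : IsProbWeight (law μ T) where
  nonneg _ := measureReal_nonneg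
  sum_eq_one := by
    simpa using (measureReal_setOf_eq_sum_law (μ := μ) hT fun _ => True).symm

/-- Grouping the points `w` by the value `g w` turns the sum over points into the sum over values,
since the logarithm is constant on each fibre. -/
theorem entropy_comp [IsFiniteMeasure μ] {T : Ω → W} (hT : ∀ w, MeasurableSet (T ⁻¹' {w}))
    {A : Type*} [Finite A] (g : W → A) :
    entropy μ (fun ω => g (T ω)) = partEntropy (law μ T) (Setoid.ker g) / Real.log 2 := by
  classical
  have := Fintype.ofFinite A
  have hm : ∀ a, μ.real ((fun ω => g (T ω)) ⁻¹' {a}) = ∑ w, if g w = a then law μ T w else 0 := by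
    intro a
    have := measureReal_setOf_eq_sum_law (μ := μ) hT fun w => g w = a
    convert this
    ext ω
    simp
  have hc : ∀ w, classMass (law μ T) (Setoid.ker g) w = μ.real ((fun ω => g (T ω)) ⁻¹' {g w}) := by
    intro w
    rw [hm, classMass]
    refine Finset.sum_congr rfl fun w' _ => ?_
    simp only [Setoid.ker_def, eq_comm]
  unfold entropy partEntropy
  congr 1
  rw [finsum_eq_sum_of_fintype]
  simp_rw [hc]
  calc ∑ a, Real.negMulLog (μ.real ((fun ω => g (T ω)) ⁻¹' {a}))
      = ∑ a, ∑ w, if g w = a then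
          law μ T w * -Real.log (μ.real ((fun ω => g (T ω)) ⁻¹' {a})) else 0 := by
        refine Finset.sum_congr rfl fun a _ => ?_
        rw [Real.negMulLog, neg_mul, ← mul_neg]
        nth_rw 1 [hm]
        rw [Finset.sum_mul]
        exact Finset.sum_congr rfl fun w _ => by rw [ite_mul, zero_mul]
    _ = _ := by
        rw [Finset.sum_comm]
        simp

theorem jointEntropy_eq_partEntropy [IsFiniteMeasure μ] {ι : Type*} {A : ι → Type*} [Finite ι]
    [∀ i, Finite (A i)] [Fintype (∀ i, A i)] {X : ∀ i, Ω → A i}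
    (hX : ∀ w : ∀ i, A i, MeasurableSet ((fun ω i => X i ω) ⁻¹' {w})) (α : Set ι) :
    jointEntropy μ X α = partEntropy (law μ fun ω i => X i ω)
      (jointSetoid (fun i => Setoid.ker fun w : ∀ i, A i => w i) α) / Real.log 2 := by
  have h := entropy_comp (μ := μ) hX fun (w : ∀ i, A i) (i : α) => w i
  rw [jointEntropy, h]
  congr 2
  ext w w'
  simp [jointSetoid_apply, Setoid.ker_def, funext_iff]

end Law

/-! ### Entropic and almost entropic functions -/

section Entropic

variable {Z W : Type*} [Finite Z] [Fintype W] {p : W → ℝ}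

/-- Entropic functions require a sample space in `Type`, while `W` may live in any universe; `Fin n`
serves for both. -/
theorem IsProbWeight.exists_law_eq (hp : IsProbWeight p) :
    ∃ (n : ℕ) (ν : Measure (Fin n)) (T : Fin n → W), IsProbabilityMeasure ν ∧ law ν T = p := by
  classical
  let e := Fintype.equivFin W
  let q : PMF (Fin (Fintype.card W)) := PMF.ofFintype (fun i => ENNReal.ofReal (p (e.symm i))) (by
    rw [← ENNReal.ofReal_sum_of_nonneg fun _ _ => hp.nonneg _, e.symm.sum_comp, hp.sum_eq_one,
      ENNReal.ofReal_one])
  refine ⟨Fintype.card W, q.toMeasure, e.symm, inferInstance, ?_⟩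
  funext w
  have : (e.symm ⁻¹' {w} : Set (Fin (Fintype.card W))) = {e w} := by
    ext i
    simp [Equiv.symm_apply_eq]
  rw [law, this, measureReal_def, PMF.toMeasure_apply_singleton _ _ (MeasurableSet.singleton _)]
  simp [q, hp.nonneg]

theorem IsProbWeight.mem_entropicFunctions (hp : IsProbWeight p) (r : Z → Setoid W) :
    (fun α => partEntropy p (jointSetoid r α) / Real.log 2) ∈ entropicFunctions Z := by
  obtain ⟨n, ν, T, hν, hlaw⟩ := hp.exists_law_eq
  -- The variable realising `r i` is the class of `w`, with the classes numbered.
  have hX : ∀ i, ∃ (k : ℕ) (f : W → Fin k), ∀ w w', f w = f w' ↔ r i w w' :=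
    fun i => ⟨_, fun w => Finite.equivFin _ (Quotient.mk (r i) w), fun w w' => by
      rw [EmbeddingLike.apply_eq_iff_eq, Quotient.eq]⟩
  choose k f hf using hX
  refine ⟨Fin n, inferInstance, ν, hν, k, fun i ω => f i (T ω), fun i => measurable_of_finite _, fun α => ?_⟩
  have h := entropy_comp (μ := ν) (T := T) (fun w => Set.Finite.measurableSet
    (Set.toFinite _)) fun (w : W) (i : α) => f i w
  have hker : Setoid.ker (fun (w : W) (i : α) => f i w) = jointSetoid r α := by
    ext w w'
    simp only [jointSetoid_apply, Setoid.ker_def, funext_iff, hf, Subtype.forall]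
  rw [jointEntropy, h, hlaw, hker]

theorem entropicFunctions_subset_polymatroids : entropicFunctions Z ⊆ polymatroids Z := by
  classical
  rintro h ⟨Ω, _, μ, _, k, X, hX, hh⟩
  have := Fintype.ofFinite Z
  have hT : ∀ w : ∀ i, Fin (k i), MeasurableSet ((fun ω i => X i ω) ⁻¹' {w}) := fun w =>
    (measurable_pi_iff.2 hX) (MeasurableSet.singleton w)
  have he : h = fun α => (Real.log 2)⁻¹ * partEntropy (law μ fun ω i => X i ω)
      (jointSetoid (fun i => Setoid.ker fun w : ∀ i, Fin (k i) => w i) α) := by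
    funext α
    rw [hh, jointEntropy_eq_partEntropy hT, div_eq_inv_mul]
  rw [he]
  exact (isProbWeight_law hT).isPolymatroid _ (inv_nonneg.2 (Real.log_nonneg one_le_two))

omit [Finite Z] in
theorem isClosed_polymatroids : IsClosed (polymatroids Z) := by
  have : polymatroids Z = {h | h ∅ = 0} ∩ {h | ∀ α β : Set Z, β ⊆ α → h β ≤ h α} ∩
      {h | ∀ α, 0 ≤ h α} ∩ {h | ∀ α β, h (α ∩ β) + h (α ∪ β) ≤ h α + h β} := by
    ext h
    exact ⟨fun H => ⟨⟨⟨H.empty, H.mono⟩, H.nonneg⟩, H.submod⟩,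
      fun H => ⟨H.1.1.1, H.1.1.2, H.1.2, H.2⟩⟩
  rw [this]
  simp only [Set.ofPred_forall]
  refine ((IsClosed.inter (isClosed_eq (by fun_prop) (by fun_prop)) ?_).inter ?_).inter ?_
  · exact isClosed_iInter fun α => isClosed_iInter fun β => isClosed_iInter fun _ =>
      isClosed_le (by fun_prop) (by fun_prop)
  · exact isClosed_iInter fun α => isClosed_le (by fun_prop) (by fun_prop)
  · exact isClosed_iInter fun α => isClosed_iInter fun β =>
      isClosed_le (by fun_prop) (by fun_prop)

theorem almostEntropicFunctions_subset_polymatroids :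
    almostEntropicFunctions Z ⊆ polymatroids Z :=
  closure_minimal entropicFunctions_subset_polymatroids isClosed_polymatroids

/-- Nonnegative multiples of entropic functions are almost entropic. -/
theorem IsProbWeight.smul_mem_almostEntropicFunctions (hp : IsProbWeight p) (r : Z → Setoid W)
    {c : ℝ} (hc : 0 < c) :
    (fun α => c * (partEntropy p (jointSetoid r α) / Real.log 2)) ∈ almostEntropicFunctions Z := by
  have ht : Tendsto (fun k : ℕ => c / k) atTop (𝓝 0) := tendsto_const_div_atTop_nhds_zero_nat c
  -- The `k`-th power multiplies entropy by `k`; mixing with weight `c / k` multiplies it by `c / k`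
  -- and adds `binEntropy (c / k)`.
  refine mem_closure_of_tendsto (b := atTop) (f := fun (k : ℕ) (α : Set Z) =>
    partEntropy (NetCod.mixWeight (NetCod.powWeight p k) (c / k))
      (jointSetoid (fun i => mixSetoid (powSetoid (r i) k)) α) / Real.log 2) ?_ ?_
  · rw [tendsto_pi_nhds]
    intro α
    -- On `∅` the approximants vanish and carry no binary entropy term.
    rcases α.eq_empty_or_nonempty with rfl | hα
    · simp only [jointSetoid_empty, hp.partEntropy_top, zero_div, mul_zero]
      refine tendsto_const_nhds.congr' ?_
      filter_upwards [ht.eventually_le_const one_pos] with k hk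
      rw [((hp.powWeight k).mixWeight (by positivity) hk).partEntropy_top, zero_div]
    · have hb : Tendsto (fun k : ℕ => (c * partEntropy p (jointSetoid r α) +
          Real.binEntropy (c / k)) / Real.log 2) atTop
          (𝓝 ((c * partEntropy p (jointSetoid r α) + 0) / Real.log 2)) := by
        refine (tendsto_const_nhds.add ?_).div_const _
        have := (Real.binEntropy_continuous.tendsto 0).comp ht
        rwa [Real.binEntropy_zero] at this
      rw [add_zero, mul_div_assoc] at hb
      refine hb.congr' ?_
      filter_upwards [eventually_gt_atTop 0] with k hk
      have hk' : (0 : ℝ) < k := Nat.cast_pos.2 hk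
      rw [jointSetoid_mix _ hα, (hp.powWeight k).partEntropy_mix _ (by positivity),
        jointSetoid_pow, hp.partEntropy_pow]
      field_simp
  · filter_upwards [ht.eventually_le_const one_pos] with k hk
    exact ((hp.powWeight k).mixWeight (by positivity) hk).mem_entropicFunctions _

end Entropic

/-! ### Partitions generated by a network code -/

section Code

variable {V E S : Type*} [Finite E] {G : Network V E S} {𝒴 : S → Type*} {N : ℕ}

/-- The partitions of the set of source blocks generated by the source and link variables. -/
def codeSetoid (φ : NetworkCode G 𝒴 N) : S ⊕ E → Setoid (Fin N → ∀ s, 𝒴 s)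
  | .inl s => Setoid.ker fun w n => w n s
  | .inr e => Setoid.ker fun w => φ.message (fun s n => w n s) e

theorem codeSetoid_inl (φ : NetworkCode G 𝒴 N) (s : S) (w w' : Fin N → ∀ s, 𝒴 s) :
    codeSetoid φ (.inl s) w w' ↔ (fun n => w n s) = fun n => w' n s := Iff.rfl

theorem codeSetoid_inr (φ : NetworkCode G 𝒴 N) (e : E) (w w' : Fin N → ∀ s, 𝒴 s) :
    codeSetoid φ (.inr e) w w' ↔
      φ.message (fun s n => w n s) e = φ.message (fun s n => w' n s) e := Iff.rfl

/-- The right side equates the two arguments of an encoder or decoder at `u`, so its output is seen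
to agree by rewriting. -/
theorem jointSetoid_available_iff (φ : NetworkCode G 𝒴 N) (u : V) (w w' : Fin N → ∀ s, 𝒴 s) :
    jointSetoid (codeSetoid φ) (G.available u) w w' ↔
      (fun (s : G.sourcesAt u) n => w n s) = (fun (s : G.sourcesAt u) n => w' n s) ∧
      (fun f : G.inLinks u => φ.message (fun s n => w n s) f) =
        fun f : G.inLinks u => φ.message (fun s n => w' n s) f := by
  rw [Network.available, jointSetoid_union]
  refine and_congr ?_ ?_
  · rw [jointSetoid_apply, Set.forall_mem_image, funext_iff, Subtype.forall]
    simp only [codeSetoid_inl]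
  · rw [jointSetoid_apply, Set.forall_mem_image, funext_iff, Subtype.forall]
    simp only [codeSetoid_inr]

theorem jointSetoid_available_le_message (φ : NetworkCode G 𝒴 N) (e : E) :
    jointSetoid (codeSetoid φ) (G.available (G.tail e)) ≤ codeSetoid φ (.inr e) := by
  intro w w' h
  obtain ⟨h1, h2⟩ := (jointSetoid_available_iff φ _ w w').1 h
  rw [codeSetoid_inr, φ.message_eq, φ.message_eq, h1, h2]

theorem jointSetoid_available_le_decoded (φ : NetworkCode G 𝒴 N) (s : S) (u : V)
    (hu : u ∈ G.b s) : jointSetoid (codeSetoid φ) (G.available u) ≤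
      Setoid.ker fun w => φ.decoded (fun s n => w n s) s u hu := by
  intro w w' h
  obtain ⟨h1, h2⟩ := (jointSetoid_available_iff φ _ w w').1 h
  rw [Setoid.ker_def, NetworkCode.decoded, NetworkCode.decoded, h1, h2]

theorem jointSetoid_image_inl (φ : NetworkCode G 𝒴 N) (α : Set S) :
    jointSetoid (codeSetoid φ) (Sum.inl '' α) =
      powSetoid (jointSetoid (fun s => Setoid.ker fun w : ∀ s, 𝒴 s => w s) α) N := by
  ext w w'
  rw [jointSetoid_apply, Set.forall_mem_image]
  simp only [codeSetoid_inl, funext_iff, powSetoid_apply, jointSetoid_apply, Setoid.ker_def]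
  exact ⟨fun h n s hs => h hs n, fun h s hs n => h n s hs⟩

/-- The source blocks determine everything in the network. This gives the upper bound, uniform in
`N`, behind compactness. -/
theorem jointSetoid_image_inl_univ_le (φ : NetworkCode G 𝒴 N) (α : Set (S ⊕ E)) :
    jointSetoid (codeSetoid φ) (Sum.inl '' Set.univ) ≤ jointSetoid (codeSetoid φ) α := by
  intro w w' h
  rw [jointSetoid_image_inl] at h
  have : w = w' := funext fun n => funext fun s => h n s trivial
  rw [this]

end Code

/-! ### Block distribution of the sources -/

section Source

variable {S Ω : Type*} [Finite S] {𝒴 : S → Type*} [∀ s, Finite (𝒴 s)] [∀ s, MeasurableSpace (𝒴 s)]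
  [∀ s, MeasurableSingletonClass (𝒴 s)] [Fintype (∀ s, 𝒴 s)] [MeasurableSpace Ω] {μ : Measure Ω}
  {Y : ℕ → ∀ s, Ω → 𝒴 s}

omit [∀ s, Finite (𝒴 s)] [Fintype (∀ s, 𝒴 s)] in
theorem measurableSet_symbols_preimage (hmeas : ∀ n s, Measurable (Y n s)) (n : ℕ)
    (w : ∀ s, 𝒴 s) : MeasurableSet ((fun ω s => Y n s ω) ⁻¹' {w}) :=
  (measurable_pi_iff.2 (hmeas n)) (MeasurableSet.singleton w)

omit [∀ s, Finite (𝒴 s)] [Fintype (∀ s, 𝒴 s)] in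
theorem measurableSet_block_preimage (hmeas : ∀ n s, Measurable (Y n s)) (N : ℕ)
    (w : Fin N → ∀ s, 𝒴 s) :
    MeasurableSet ((fun ω (n : Fin N) s => Y n s ω) ⁻¹' {w}) :=
  (measurable_pi_iff.2 fun n : Fin N => measurable_pi_iff.2 (hmeas n)) (MeasurableSet.singleton w)

omit [∀ s, Finite (𝒴 s)] [Fintype (∀ s, 𝒴 s)] in
/-- The distribution of a block of an i.i.d. sequence is a product distribution. -/
theorem law_block
    (hindep : iIndepFun (fun (n : ℕ) (ω : Ω) (s : S) => Y n s ω) μ)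
    (hident : ∀ n : ℕ, IdentDistrib (fun (ω : Ω) (s : S) => Y n s ω)
      (fun (ω : Ω) (s : S) => Y 0 s ω) μ μ) (N : ℕ) :
    law μ (fun ω (n : Fin N) s => Y n s ω) = powWeight (law μ fun ω s => Y 0 s ω) N := by
  funext w
  have hset : ((fun ω (n : Fin N) s => Y n s ω) ⁻¹' {w}) =
      ⋂ n : Fin N, (fun ω s => Y n s ω) ⁻¹' {w n} := by
    ext ω
    simp [funext_iff]
  have h := (hindep.precomp (Fin.val_injective (n := N))).meas_iInter
    (s := fun n : Fin N => (fun ω s => Y n s ω) ⁻¹' {w n})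
    fun n => ⟨{w n}, MeasurableSet.singleton _, rfl⟩
  rw [law, hset, measureReal_def, h, ENNReal.toReal_prod, powWeight]
  refine Finset.prod_congr rfl fun n _ => ?_
  rw [(hident n).measure_mem_eq (MeasurableSet.singleton (w n))]
  rfl

end Source

/-! ### Passage to the limit -/

section OuterBound

variable {V E S Ω : Type*} [Finite E] [Finite S] {G : Network V E S} {𝒴 : S → Type*}
  [∀ s, Finite (𝒴 s)] [MeasurableSpace Ω] {μ : Measure Ω} {Y : ℕ → ∀ s, Ω → 𝒴 s}

omit [Finite E] in
theorem outerRegion_mono {Δ Δ' : Set (Set (S ⊕ E) → ℝ)} (h : Δ ⊆ Δ') :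
    outerRegion G μ Y Δ ⊆ outerRegion G μ Y Δ' :=
  fun _ ⟨f, hf, hC⟩ => ⟨f, h hf, hC⟩

theorem achievableRegion_subset_outerRegion [∀ s, MeasurableSpace (𝒴 s)]
    [∀ s, MeasurableSingletonClass (𝒴 s)] [IsProbabilityMeasure μ]
    (hmeas : ∀ n s, Measurable (Y n s))
    (hindep : iIndepFun (fun (n : ℕ) (ω : Ω) (s : S) => Y n s ω) μ)
    (hident : ∀ n : ℕ, IdentDistrib (fun (ω : Ω) (s : S) => Y n s ω)
      (fun (ω : Ω) (s : S) => Y 0 s ω) μ μ) :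
    achievableRegion G μ Y ⊆ outerRegion G μ Y (almostEntropicFunctions (S ⊕ E)) := by
  classical
  rintro C ⟨φ, hrate, herr⟩
  have := Fintype.ofFinite (∀ s, 𝒴 s)
  set p : (∀ s, 𝒴 s) → ℝ := law μ fun ω s => Y 0 s ω with hp_def
  have hX := measurableSet_symbols_preimage hmeas 0
  have hp : IsProbWeight p := isProbWeight_law hX
  have hpN : ∀ N, IsProbWeight (powWeight p N) := hp.powWeight
  have hlog : 0 < Real.log 2 := Real.log_pos one_lt_two
  set g : ℕ → Set (S ⊕ E) → ℝ := fun N α =>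
    (N : ℝ)⁻¹ * (partEntropy (powWeight p N) (jointSetoid (codeSetoid (φ N)) α) / Real.log 2)
    with hg_def
  have hsrc : ∀ N, 0 < N → ∀ α, g N (Sum.inl '' α) = jointEntropy μ (Y 0) α := by
    intro N hN α
    have : (N : ℝ) ≠ 0 := Nat.cast_ne_zero.2 hN.ne'
    simp only [hg_def]
    rw [jointSetoid_image_inl, hp.partEntropy_pow, jointEntropy_eq_partEntropy hX]
    field_simp
    rfl
  have hmono : ∀ N {α β}, jointSetoid (codeSetoid (φ N)) α ≤ jointSetoid (codeSetoid (φ N)) β →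
      g N β ≤ g N α := by
    intro N α β h
    have := (hpN N).partEntropy_anti h
    simp only [hg_def]
    gcongr
  have hnonneg : ∀ N α, 0 ≤ g N α := fun N α =>
    mul_nonneg (by positivity) (div_nonneg ((hpN N).partEntropy_nonneg _) hlog.le)
  -- An ultrafilter finer than `atTop` plays the role of a convergent subsequence. The block length
  -- `0`, for which `g` vanishes identically, is not seen by it.
  let F : Ultrafilter ℕ := Ultrafilter.of atTop
  have hF : (F : Filter ℕ) ≤ atTop := Ultrafilter.of_le _
  have hpos : ∀ᶠ N in F, 0 < N := (eventually_gt_atTop 0).filter_mono hF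
  obtain ⟨h, -, hlim⟩ : ∃ h ∈ Set.univ.pi fun _ : Set (S ⊕ E) =>
      Set.Icc 0 (jointEntropy μ (Y 0) Set.univ), Tendsto g F (𝓝 h) := by
    refine (isCompact_univ_pi fun _ => isCompact_Icc).ultrafilter_le_nhds (F.map g) ?_
    rw [Ultrafilter.coe_map, le_principal_iff, mem_map]
    filter_upwards [hpos] with N hN α _
    refine ⟨hnonneg N α, ?_⟩
    rw [← hsrc N hN]
    exact hmono N (jointSetoid_image_inl_univ_le _ _)
  have hlim' : ∀ α, Tendsto (fun N => g N α) F (𝓝 (h α)) := tendsto_pi_nhds.1 hlim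
  have hinv : Tendsto (fun N : ℕ => (N : ℝ)⁻¹) F (𝓝 0) :=
    tendsto_inv_atTop_nhds_zero_nat.mono_left hF
  refine ⟨h, ?_, fun α => ?_, fun e => ?_, fun s u hu => ?_, fun e => ?_⟩
  · refine isClosed_closure.mem_of_tendsto hlim ?_
    filter_upwards [hpos] with N hN
    exact (hpN N).smul_mem_almostEntropicFunctions _ (inv_pos.2 (Nat.cast_pos.2 hN))
  · rw [sub_eq_zero]
    refine tendsto_nhds_unique (hlim' _) (tendsto_const_nhds.congr' ?_)
    filter_upwards [hpos] with N hN
    rw [hsrc N hN]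
  -- The encoding constraint holds exactly for every `N`, hence in the limit.
  · rw [condValue, sub_eq_zero]
    refine tendsto_nhds_unique (hlim' _) ((hlim' _).congr fun N => ?_)
    simp only [hg_def]
    rw [jointSetoid_union, jointSetoid_singleton,
      inf_eq_right.2 (jointSetoid_available_le_message (φ N) e)]
  -- Fano's inequality divided by `N`: the alphabet of a block has logarithm `N * log |𝒴 s|`, so the
  -- factor of the error probability does not grow, and `log 2` becomes `1 / N` in bits.
  · have hle : ∀ N, 0 < N → g N ({Sum.inl s} ∪ G.available u) - g N (G.available u) ≤
        (N : ℝ)⁻¹ + μ.real {ω | (φ N).decoded (block Y N ω) s u hu ≠ block Y N ω s} *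
          (Real.log (Nat.card (𝒴 s)) / Real.log 2) := by
      intro N hN
      have hN' : (0 : ℝ) < N := Nat.cast_pos.2 hN
      have hf := (hpN N).partEntropy_ker_inf_le (fun w n => w n s) _ _
        (jointSetoid_available_le_decoded (φ N) s u hu)
      have he := measureReal_setOf_eq_sum_law (μ := μ) (measurableSet_block_preimage hmeas N)
        fun w => (fun n => w n s) ≠ (φ N).decoded (fun s n => w n s) s u hu
      rw [law_block hindep hident, ← hp_def] at he
      rw [← he, Nat.card_fun, Nat.card_fin, Nat.cast_pow, Real.log_pow] at hf
      have hset : {ω | (fun n : Fin N => Y n s ω) ≠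
          (φ N).decoded (fun s (n : Fin N) => Y n s ω) s u hu} =
          {ω | (φ N).decoded (block Y N ω) s u hu ≠ block Y N ω s} := by
        ext ω
        exact ne_comm
      rw [hset] at hf
      simp only [hg_def]
      rw [jointSetoid_union, jointSetoid_singleton, ← mul_sub, ← sub_div, inv_mul_le_iff₀ hN',
        div_le_iff₀ hlog]
      refine (sub_le_iff_le_add'.2 hf).trans_eq ?_
      field_simp
    rw [condValue]
    refine tendsto_nhds_unique ((hlim' _).sub (hlim' _)) ?_
    have hup : Tendsto (fun N : ℕ => (N : ℝ)⁻¹ +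
        μ.real {ω | (φ N).decoded (block Y N ω) s u hu ≠ block Y N ω s} *
          (Real.log (Nat.card (𝒴 s)) / Real.log 2)) F (𝓝 0) := by
      simpa using hinv.add (((herr s u hu).mono_left hF).mul_const _)
    refine squeeze_zero' (Eventually.of_forall fun N => ?_) ?_ hup
    · exact sub_nonneg.2 (hmono N (jointSetoid_anti _ Set.subset_union_right))
    · filter_upwards [hpos] with N hN using hle N hN
  · refine le_of_forall_pos_le_add fun ε hε => ?_
    refine le_of_tendsto (hlim' _) ?_
    filter_upwards [(hrate e ε hε).filter_mono hF, hpos] with N hN hN0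
    have := (φ N).finite_U e
    refine le_trans ?_ hN
    simp only [hg_def]
    rw [jointSetoid_singleton, Real.logb, div_eq_inv_mul _ (N : ℝ)]
    have := (hpN N).partEntropy_ker_le_log_card fun w => (φ N).message (fun s n => w n s) e
    gcongr
    exact this

end OuterBound

end NetCod

theorem theorem1 {V E S Ω : Type*} [Finite V] [Finite E] [Finite S]
    (G : NetCod.Network V E S)
    {𝒴 : S → Type*} [∀ s, Finite (𝒴 s)] [∀ s, MeasurableSpace (𝒴 s)]
    [∀ s, MeasurableSingletonClass (𝒴 s)]
    [MeasurableSpace Ω] (μ : Measure Ω) [IsProbabilityMeasure μ]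
    (Y : ℕ → ∀ s, Ω → 𝒴 s)
    (hmeas : ∀ n s, Measurable (Y n s))
    (hindep : iIndepFun (fun (n : ℕ) (ω : Ω) (s : S) => Y n s ω) μ)
    (hident : ∀ n : ℕ, IdentDistrib (fun (ω : Ω) (s : S) => Y n s ω)
      (fun (ω : Ω) (s : S) => Y 0 s ω) μ μ) :
    NetCod.achievableRegion G μ Y ⊆
        NetCod.outerRegion G μ Y (NetCod.almostEntropicFunctions (S ⊕ E)) ∧
      NetCod.outerRegion G μ Y (NetCod.almostEntropicFunctions (S ⊕ E)) ⊆
        NetCod.outerRegion G μ Y (NetCod.polymatroids (S ⊕ E)) :=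
  ⟨NetCod.achievableRegion_subset_outerRegion hmeas hindep hident,
    NetCod.outerRegion_mono NetCod.almostEntropicFunctions_subset_polymatroids⟩
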